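/- Let $k \ge 2$, $d \ge 2$ and $D \ge 1$ be integers, and let $S_k$ be the symmetric group on $k$ letters, with identity $e$. For $\pi \in S_k$ let $\#(\pi)$ be the number of cycles of $\pi$ in its decomposition into disjoint cycles (fixed points included). For a positive integer $q$ let $G$ be the $k! \times k!$ Gram matrix with entries $G_{\sigma\tau} = q^{\#(\sigma\tau^{-1})}$, $\sigma,\tau \in S_k$, and let the Weingarten function $\mathrm{Wg}(\cdot, q)$ be defined by $\mathrm{Wg}(\sigma\tau^{-1}, q) = (G^{-1})_{\sigma\tau}$ if $k \le q$, and by the same formula with the Moore--Penrose inverse of $G$ in place of $G^{-1}$ if $k > q$. Let $T_e \in \mathbb{R}^{k! \times k!}$ be the $k$-replica transfer matrix of random matrix product states with physical dimension $d$ and bond dimension $D$, $$ (T_e)_{\tau\theta} = \sum_{\sigma \in S_k} \mathrm{Wg}(\sigma\tau^{-1}, dD)\, d^{\#(\sigma)}\, D^{\#(\sigma\theta^{-1})}, \qquad \tau, \theta \in S_k . $$ Then all complex eigenvalues of $T_e$ are real and non-negative, so that its distinct eigenvalues can be written $\lambda_1 > \lambda_2 > \cdots \ge 0$; the largest one is $\lambda_1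 = 1$, and it is non-degenerate, i.e. its algebraic and its geometric multiplicity are both equal to $1$. -/

import Mathlib

namespace RandomMPS

open Equiv

/-- The number `#(π)` of cycles in the decomposition of `π ∈ S_k` into disjoint cycles, where
fixed points count as cycles of length one; that is, the number of orbits of `π`. -/
noncomputable def numCycles {k : ℕ} (π : Perm (Fin k)) : ℕ :=
  Nat.card (Quotient (Perm.SameCycle.setoid π))

/-- The Gram matrix of the permutation operators on `(ℂ^q)^{⊗ k}`,
`G_{στ} = q ^ #(σ τ⁻¹)`. -/
noncomputable def gram (k q : ℕ) : Matrix (Perm (Fin k)) (Perm (Fin k)) ℝ :=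
  Matrix.of fun σ τ => (q : ℝ) ^ numCycles (σ * τ⁻¹)

/-- The Weingarten matrix: the Moore-Penrose inverse of the Gram matrix, obtained by applying
`x ↦ x⁻¹` (with `0⁻¹ = 0`) to the eigenvalues of the Gram matrix. It is the inverse of
the Gram matrix whenever that matrix is invertible (equivalently, `k ≤ q`), and it extends the
Weingarten function in the usual way when `k > q`. -/
noncomputable def weingartenMatrix (k q : ℕ) : Matrix (Perm (Fin k)) (Perm (Fin k)) ℝ :=
  cfc (fun x : ℝ => x⁻¹) (gram k q)

/-- The Weingarten function `Wg(π, q)` on `S_k`, so that `Wg(σ τ⁻¹, q)` is the entry of the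
Weingarten matrix at `(σ, τ)` (see `wg_mul_inv`). -/
noncomputable def wg {k : ℕ} (π : Perm (Fin k)) (q : ℕ) : ℝ :=
  weingartenMatrix k q π 1

/-- The `k`-replica transfer matrix `T_ρ` of random matrix product states with physical dimension
`d` and bond dimension `D`:
`⟨τ|T_ρ|θ⟩ = ∑_σ Wg(σ τ⁻¹, d D) d ^ #(σ ρ) D ^ #(σ θ⁻¹)`. -/
noncomputable def transferMatrix {k : ℕ} (d D : ℕ) (ρ : Perm (Fin k)) :
    Matrix (Perm (Fin k)) (Perm (Fin k)) ℝ :=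
  Matrix.of fun τ θ => ∑ σ : Perm (Fin k),
    wg (σ * τ⁻¹) (d * D) * (d : ℝ) ^ numCycles (σ * ρ) * (D : ℝ) ^ numCycles (σ * θ⁻¹)

theorem numCycles_inv {k : ℕ} (π : Perm (Fin k)) : numCycles π⁻¹ = numCycles π := by
  have h : Perm.SameCycle.setoid π⁻¹ = Perm.SameCycle.setoid π :=
    Setoid.ext fun _ _ => Perm.sameCycle_inv
  unfold numCycles
  rw [h]

theorem gram_isSelfAdjoint (k q : ℕ) : IsSelfAdjoint (gram k q) := by
  ext σ τ
  have h : τ * σ⁻¹ = (σ * τ⁻¹)⁻¹ := by simp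
  simp only [gram, Matrix.star_apply, Matrix.of_apply, star_trivial, h, numCycles_inv]

theorem continuousOn_spectrum_gram (k q : ℕ) (f : ℝ → ℝ) :
    ContinuousOn f (spectrum ℝ (gram k q)) :=
  (Matrix.finite_real_spectrum (A := gram k q)).continuousOn f

theorem weingartenMatrix_isSelfAdjoint (k q : ℕ) : IsSelfAdjoint (weingartenMatrix k q) :=
  cfc_predicate _ _

theorem weingartenMatrix_commute_gram (k q : ℕ) :
    weingartenMatrix k q * gram k q = gram k q * weingartenMatrix k q :=
  ((gram_isSelfAdjoint k q).commute_cfc (Commute.refl _) _).eq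

theorem gram_mul_weingartenMatrix_mul_gram (k q : ℕ) :
    gram k q * weingartenMatrix k q * gram k q = gram k q := by
  have hc := continuousOn_spectrum_gram k q
  have hG : cfc (fun x : ℝ => x) (gram k q) = gram k q := cfc_id' ℝ _ (gram_isSelfAdjoint k q)
  have h : cfc (fun x : ℝ => x * x⁻¹ * x) (gram k q)
      = cfc (fun x : ℝ => x) (gram k q) * cfc (fun x : ℝ => x⁻¹) (gram k q)
        * cfc (fun x : ℝ => x) (gram k q) := by
    rw [cfc_mul (fun x : ℝ => x * x⁻¹) (fun x => x) _ (hc _) (hc _),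
      cfc_mul (fun x : ℝ => x) (fun x => x⁻¹) _ (hc _) (hc _)]
  simp only [mul_inv_mul_cancel, hG] at h
  exact h.symm

theorem weingartenMatrix_mul_gram_mul_weingartenMatrix (k q : ℕ) :
    weingartenMatrix k q * gram k q * weingartenMatrix k q = weingartenMatrix k q := by
  have hc := continuousOn_spectrum_gram k q
  have hG : cfc (fun x : ℝ => x) (gram k q) = gram k q := cfc_id' ℝ _ (gram_isSelfAdjoint k q)
  have h : cfc (fun x : ℝ => x⁻¹ * x * x⁻¹) (gram k q)
      = cfc (fun x : ℝ => x⁻¹) (gram k q) * cfc (fun x : ℝ => x) (gram k q)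
        * cfc (fun x : ℝ => x⁻¹) (gram k q) := by
    rw [cfc_mul (fun x : ℝ => x⁻¹ * x) (fun x => x⁻¹) _ (hc _) (hc _),
      cfc_mul (fun x : ℝ => x⁻¹) (fun x => x) _ (hc _) (hc _)]
  have e : (fun x : ℝ => x⁻¹ * x * x⁻¹) = fun x => x⁻¹ := by
    funext x
    simpa using mul_inv_mul_cancel x⁻¹
  rw [e, hG] at h
  exact h.symm

/-- Where the Gram matrix is invertible, the Weingarten matrix is its inverse. -/
theorem weingartenMatrix_eq_inv (k q : ℕ) (h : IsUnit (gram k q)) :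
    weingartenMatrix k q = (gram k q)⁻¹ := by
  have h1 := gram_mul_weingartenMatrix_mul_gram k q
  have h2 : gram k q * weingartenMatrix k q = 1 := by
    apply h.mul_right_cancel
    rw [h1, one_mul]
  exact (Matrix.inv_eq_right_inv h2).symm

/-- The entries of the Weingarten matrix are `Wg(σ τ⁻¹, q)`. -/
theorem wg_mul_inv {k : ℕ} (q : ℕ) (σ τ : Perm (Fin k)) :
    wg (σ * τ⁻¹) q = weingartenMatrix k q σ τ := by
  have hP : Commute (gram k q) ((Equiv.mulRight τ).toPEquiv.toMatrix) := by
    ext α β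
    rw [PEquiv.toMatrix_toPEquiv_mul, PEquiv.mul_toMatrix_toPEquiv]
    simp [gram, mul_assoc]
  have hW : Commute (weingartenMatrix k q) ((Equiv.mulRight τ).toPEquiv.toMatrix) :=
    (gram_isSelfAdjoint k q).commute_cfc hP _
  have h := congrFun (congrFun hW.eq (σ * τ⁻¹)) τ
  rw [PEquiv.toMatrix_toPEquiv_mul, PEquiv.mul_toMatrix_toPEquiv] at h
  simpa [wg] using h

end RandomMPS

/-! Write `T = W Δ G`, where `G` is the Gram matrix for `D`, `W` the Weingarten matrix for `dD`, and
`Δ` the positive diagonal matrix of the `d ^ #(σ)`. All Gram matrices commute, so `P = G W` is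
positive semidefinite, and `G T = P Δ G`. Thus `T` acts on the image of `G` as `P Δ`, which is
self-adjoint and non-negative for the inner product weighted by `Δ`, and `T` kills `ker G`. This
gives real non-negative eigenvalues and rules out Jordan blocks at `1` (`eigenvalue_nonneg`,
`transferMatrix_semisimple`).

For the bound and the multiplicity, read a vector `x` as the operator `Z = ∑ x_σ σ` on `(ℂ^D)^{⊗k}`.
Then `T x` holds coefficients of `E(1 ⊗ Z)`, where `E` is the trace-preserving conditional
expectation onto the span of the permutations of `(ℂ^d ⊗ ℂ^D)^{⊗k}`. Since `E` is unital, `1` is an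
eigenvalue. Kadison–Schwarz, tested on `e₀^{⊗k} ⊗ φ` with `φ` a top eigenvector of `Z* Z`, gives
`|μ| ≤ 1`.

If `μ = 1`, equality puts every such vector in the kernel of `E(1 ⊗ (m - Z* Z))`. That kernel is
stable under the commutant of the permutations and lies in the kernel of `1 ⊗ (m - Z* Z)`. A
commutant element moving one slot from `e₀` to `e₁` (here `d ≥ 2` enters) shows that the top
eigenspace is stable under all one-slot operators, so `Z* Z = m`. Subtracting from `Z` one of its
eigenvalues makes it singular, hence zero: `Z` is scalar. -/

namespace RandomMPS

open Matrix
open scoped ComplexOrder MatrixOrder Kronecker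

/-! ### Conditional expectations onto matrix *-subalgebras -/

section CondExp

variable {n : Type*} [Fintype n] [DecidableEq n]

/-- `a` is the trace-preserving conditional expectation of `X` onto the `*`-subalgebra `A`. -/
def IsCondExp (A : StarSubalgebra ℂ (Matrix n n ℂ)) (X a : Matrix n n ℂ) : Prop :=
  a ∈ A ∧ ∀ b ∈ A, trace (b * X) = trace (b * a)

theorem conjTranspose_mem {A : StarSubalgebra ℂ (Matrix n n ℂ)} {a : Matrix n n ℂ} (ha : a ∈ A) :
    aᴴ ∈ A :=
  star_mem ha

/-- The spectrum is finite, so Lagrange interpolation turns `f` into a polynomial. -/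
theorem cfc_mem_starSubalgebra {A : StarSubalgebra ℂ (Matrix n n ℂ)} {a : Matrix n n ℂ}
    (ha : a ∈ A) (hsa : IsSelfAdjoint a) (f : ℝ → ℝ) : cfc f a ∈ A := by
  classical
  have hfin : (spectrum ℝ a).Finite := Matrix.finite_real_spectrum
  set p := Lagrange.interpolate hfin.toFinset id f with hp
  have h : cfc f a = Polynomial.aeval a p := by
    rw [← cfc_polynomial p a hsa]
    refine cfc_congr fun x hx => ?_
    have := Lagrange.eval_interpolate_at_node (s := hfin.toFinset) (v := id) f
      Function.injective_id.injOn (hfin.mem_toFinset.2 hx)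
    exact this.symm
  rw [h, Polynomial.aeval_eq_sum_range]
  refine sum_mem fun i _ => ?_
  have : p.coeff i • a ^ i = (p.coeff i : ℂ) • a ^ i := by
    ext; simp
  rw [this]
  exact A.smul_mem (pow_mem ha i) _

theorem IsCondExp.conjTranspose {A : StarSubalgebra ℂ (Matrix n n ℂ)} {X a : Matrix n n ℂ}
    (h : IsCondExp A X a) : IsCondExp A Xᴴ aᴴ := by
  refine ⟨conjTranspose_mem h.1, fun b hb => ?_⟩
  have := congrArg star (h.2 bᴴ (conjTranspose_mem hb))
  rw [← trace_conjTranspose, ← trace_conjTranspose] at this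
  rw [conjTranspose_mul, conjTranspose_mul, conjTranspose_conjTranspose] at this
  rw [trace_mul_comm b, trace_mul_comm b, this]

theorem IsCondExp.sub {A : StarSubalgebra ℂ (Matrix n n ℂ)} {X Y a b : Matrix n n ℂ}
    (h : IsCondExp A X a) (h' : IsCondExp A Y b) : IsCondExp A (X - Y) (a - b) :=
  ⟨sub_mem h.1 h'.1, fun c hc => by simp [mul_sub, h.2 c hc, h'.2 c hc]⟩

theorem IsCondExp.of_mem {A : StarSubalgebra ℂ (Matrix n n ℂ)} {a : Matrix n n ℂ} (h : a ∈ A) :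
    IsCondExp A a a :=
  ⟨h, fun _ _ => rfl⟩

theorem IsCondExp.smul {A : StarSubalgebra ℂ (Matrix n n ℂ)} {X a : Matrix n n ℂ}
    (h : IsCondExp A X a) (c : ℂ) : IsCondExp A (c • X) (c • a) :=
  ⟨A.smul_mem h.1 c, fun b hb => by simp [h.2 b hb]⟩

theorem IsCondExp.unique {A : StarSubalgebra ℂ (Matrix n n ℂ)} {X a b : Matrix n n ℂ}
    (h : IsCondExp A X a) (h' : IsCondExp A X b) : a = b := by
  have hm : (a - b)ᴴ ∈ A := conjTranspose_mem (sub_mem h.1 h'.1)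
  have : trace ((a - b)ᴴ * (a - b)) = 0 := by
    rw [mul_sub, trace_sub, ← h.2 _ hm, ← h'.2 _ hm, sub_self]
  exact sub_eq_zero.1 (trace_conjTranspose_mul_self_eq_zero_iff.1 this)

theorem IsCondExp.bimodule {A : StarSubalgebra ℂ (Matrix n n ℂ)} {X a b c : Matrix n n ℂ}
    (h : IsCondExp A X a) (hb : b ∈ A) (hc : c ∈ A) : IsCondExp A (b * X * c) (b * a * c) := by
  refine ⟨mul_mem (mul_mem hb h.1) hc, fun e he => ?_⟩
  have := h.2 (c * e * b) (mul_mem (mul_mem hc he) hb)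
  rw [show e * (b * X * c) = (e * b * X) * c by noncomm_ring,
    show e * (b * a * c) = (e * b * a) * c by noncomm_ring, trace_mul_comm _ c, trace_mul_comm _ c]
  simpa [mul_assoc] using this

/-- Let `Q ∈ A` be the spectral projection of `a` onto `(-∞, 0]`. Then `tr (Q X Q) = tr (Q a)` is
both non-negative and non-positive, which forces `Q a = 0` and `X Q = 0`. The second equation is
faithfulness of the expectation. -/
theorem IsCondExp.posSemidef_and_ker {A : StarSubalgebra ℂ (Matrix n n ℂ)} {X a : Matrix n n ℂ}
    (h : IsCondExp A X a) (hX : X.PosSemidef) :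
    a.PosSemidef ∧ ∀ v : n → ℂ, a *ᵥ v = 0 → X *ᵥ v = 0 := by
  have hsa : IsSelfAdjoint a := by
    have h1 := h.conjTranspose
    rw [hX.1.eq] at h1
    exact h1.unique h
  have hc : ∀ f : ℝ → ℝ, ContinuousOn f (spectrum ℝ a) := fun f =>
    (Matrix.finite_real_spectrum (A := a)).continuousOn f
  set f : ℝ → ℝ := fun x => if x ≤ 0 then 1 else 0 with hf
  set Q := cfc f a with hQ
  have hQA : Q ∈ A := cfc_mem_starSubalgebra h.1 hsa f
  have hQsa : Qᴴ = Q := (cfc_predicate f a : IsSelfAdjoint _)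
  have hQQ : Q * Q = Q := by
    rw [hQ, ← cfc_mul f f a (hc _) (hc _)]
    congr 1
    funext x
    simp only [hf]; split_ifs <;> simp
  have hid : cfc (fun x : ℝ => x) a = a := cfc_id' ℝ a hsa
  have hQa : Q * a = cfc (fun x => f x * x) a := by
    rw [cfc_mul f (fun x => x) a (hc _) (hc _), hid]
  have hneg : (-(Q * a)).PosSemidef := by
    rw [← nonneg_iff_posSemidef, hQa, ← cfc_neg]
    refine cfc_nonneg fun x _ => ?_
    simp only [hf]; split_ifs with hx <;> simp [hx]
  have hQXQ : (Q * X * Q).PosSemidef := by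
    have := hX.mul_mul_conjTranspose_same Q
    rwa [hQsa] at this
  have htr : trace (Q * X * Q) = trace (Q * a) := by
    rw [trace_mul_comm, ← mul_assoc, hQQ, h.2 Q hQA]
  have h0 : trace (Q * X * Q) = 0 := by
    refine le_antisymm ?_ hQXQ.trace_nonneg
    have := hneg.trace_nonneg
    rw [trace_neg] at this
    rw [htr]
    exact neg_nonneg.1 this
  have hQa0 : Q * a = 0 := by
    have := (hneg.trace_eq_zero_iff).1 (by rw [trace_neg, ← htr, h0, neg_zero])
    simpa using this
  have hXQ : X * Q = 0 := by
    have h1 : Q * X * Q = 0 := (hQXQ.trace_eq_zero_iff).1 h0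
    ext i j
    have h2 := hX.dotProduct_mulVec_zero_iff (Q *ᵥ Pi.single j 1)
    have h3 : star (Q *ᵥ Pi.single j 1) ⬝ᵥ X *ᵥ Q *ᵥ Pi.single j 1 = 0 := by
      rw [star_mulVec, hQsa, ← dotProduct_mulVec, mulVec_mulVec, mulVec_mulVec, h1]
      simp
    have h4 := congrFun (h2.1 h3) i
    rw [mulVec_mulVec] at h4
    simpa using h4
  refine ⟨?_, fun v hv => ?_⟩
  · have : a = cfc (fun x => x - f x * x) a := by
      rw [cfc_sub (fun x => x) (fun x => f x * x) a (hc _) (hc _), hid, ← hQa, hQa0, sub_zero]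
    rw [this, ← nonneg_iff_posSemidef]
    refine cfc_nonneg fun x _ => ?_
    simp only [hf]; split_ifs with hx <;> simp
    exact (not_le.1 hx).le
  -- Since `X Q = 0`, this exhibits `X` as a left multiple of `a`. As `f 0 = 1`, the default value
  -- `0⁻¹ = 0` plays no role.
  · have h2 : X * cfc (fun x : ℝ => (1 - f x) * x⁻¹ * x + f x) a = X := by
      have : (fun x : ℝ => (1 - f x) * x⁻¹ * x + f x) = fun _ => 1 := by
        funext x
        simp only [hf]; split_ifs with hx
        · simp
        · have : x ≠ 0 := by rintro rfl; exact hx le_rfl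
          field_simp; simp
      rw [this, cfc_const_one ℝ a, mul_one]
    rw [cfc_add (a := a) (fun x : ℝ => (1 - f x) * x⁻¹ * x) f (hc _) (hc _),
      cfc_mul (fun x : ℝ => (1 - f x) * x⁻¹) (fun x => x) a (hc _) (hc _), hid, mul_add, hXQ,
      add_zero] at h2
    rw [← h2, ← mulVec_mulVec, ← mulVec_mulVec, hv]
    simp

/-- By the bimodule property, the difference is the expectation of `(X - a)ᴴ * (X - a)`. -/
theorem IsCondExp.schwarz {A : StarSubalgebra ℂ (Matrix n n ℂ)} {X a b : Matrix n n ℂ}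
    (h : IsCondExp A X a) (h' : IsCondExp A (Xᴴ * X) b) : (b - aᴴ * a).PosSemidef := by
  have haA := h.1
  have ha' : aᴴ ∈ A := conjTranspose_mem h.1
  have h1 := h.bimodule ha' (one_mem A)
  have h2 := h.conjTranspose.bimodule (one_mem A) haA
  have h3 := IsCondExp.of_mem (mul_mem ha' haA)
  have h4 : IsCondExp A ((X - a)ᴴ * (X - a)) (b - aᴴ * a) := by
    have := ((h'.sub h1).sub h2).sub ((h3.sub h3).sub h3)
    convert this using 1
    · rw [conjTranspose_sub]; noncomm_ring
    · noncomm_ring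
  exact (h4.posSemidef_and_ker (posSemidef_conjTranspose_mul_self _)).1

theorem exists_max_eigenvector [Nonempty n] {A : Matrix n n ℂ} (hA : A.IsHermitian) :
    ∃ (m : ℝ) (φ : n → ℂ), φ ≠ 0 ∧ A *ᵥ φ = (m : ℂ) • φ ∧
      ((m : ℂ) • (1 : Matrix n n ℂ) - A).PosSemidef := by
  obtain ⟨i, hi⟩ := Finite.exists_max hA.eigenvalues
  refine ⟨hA.eigenvalues i, (hA.eigenvectorBasis i).ofLp, ?_, ?_, ?_⟩
  · intro h0
    have := hA.eigenvectorBasis.orthonormal.ne_zero i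
    exact this (by ext j; simpa using congrFun h0 j)
  · have := hA.mulVec_eigenvectorBasis i
    rw [this]; ext j; simp
  · rw [← le_iff]
    have : A ≤ algebraMap ℝ _ (hA.eigenvalues i) := by
      refine le_algebraMap_of_spectrum_le (a := A) (fun x hx => ?_) hA
      rw [hA.spectrum_real_eq_range_eigenvalues] at hx
      obtain ⟨j, rfl⟩ := hx
      exact hi j
    convert this using 1
    ext j l
    simp [Algebra.algebraMap_eq_smul_one]

end CondExp
-- Group algebra of a unitary representation
section GroupAlgebra

variable {G n : Type*} [Group G] [Fintype G] [Fintype n] [DecidableEq n]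

/-- The linear extension of a matrix representation to the group algebra. -/
noncomputable def groupSum (ρ : G →* Matrix n n ℂ) : (G → ℂ) →ₗ[ℂ] Matrix n n ℂ where
  toFun x := ∑ g, x g • ρ g
  map_add' x y := by simp [add_smul, Finset.sum_add_distrib]
  map_smul' c x := by simp [Finset.smul_sum, mul_smul]

theorem groupSum_apply (ρ : G →* Matrix n n ℂ) (x : G → ℂ) : groupSum ρ x = ∑ g, x g • ρ g :=
  rfl

theorem groupSum_single [DecidableEq G] (ρ : G →* Matrix n n ℂ) (g : G) :
    groupSum ρ (Pi.single g 1) = ρ g := by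
  simp [groupSum_apply, Pi.single_apply, ite_smul]

theorem groupSum_mul (ρ : G →* Matrix n n ℂ) (x y : G → ℂ) :
    groupSum ρ x * groupSum ρ y = groupSum ρ fun g => ∑ h, x h * y (h⁻¹ * g) := by
  simp only [groupSum_apply, Finset.sum_mul, Finset.mul_sum, Finset.sum_smul]
  rw [Finset.sum_comm]
  conv_rhs => rw [Finset.sum_comm]
  refine Finset.sum_congr rfl fun h _ => ?_
  refine Fintype.sum_equiv (Equiv.mulLeft h) _ _ fun g => ?_
  simp [smul_smul, mul_comm]

theorem groupSum_conjTranspose (ρ : G →* Matrix n n ℂ) (hρ : ∀ g, (ρ g)ᴴ = ρ g⁻¹) (x : G → ℂ) :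
    (groupSum ρ x)ᴴ = groupSum ρ fun g => star (x g⁻¹) := by
  simp only [groupSum_apply, conjTranspose_sum, conjTranspose_smul, hρ]
  exact Fintype.sum_equiv (Equiv.inv G) _ _ fun g => by simp

/-- The image of the group algebra under a unitary matrix representation. -/
noncomputable def groupAlgebraImage (ρ : G →* Matrix n n ℂ) (hρ : ∀ g, (ρ g)ᴴ = ρ g⁻¹) :
    StarSubalgebra ℂ (Matrix n n ℂ) where
  carrier := Set.range (groupSum ρ)
  mul_mem' := by
    rintro _ _ ⟨x, rfl⟩ ⟨y, rfl⟩
    exact ⟨_, (groupSum_mul ρ x y).symm⟩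
  add_mem' := by
    rintro _ _ ⟨x, rfl⟩ ⟨y, rfl⟩
    exact ⟨x + y, map_add _ _ _⟩
  algebraMap_mem' c := by
    classical
    exact ⟨c • Pi.single 1 1, by
      rw [map_smul, groupSum_single, map_one, Algebra.algebraMap_eq_smul_one]⟩
  star_mem' := by
    rintro _ ⟨x, rfl⟩
    exact ⟨_, (groupSum_conjTranspose ρ hρ x).symm⟩

theorem isCondExp_groupAlgebraImage {ρ : G →* Matrix n n ℂ} {hρ : ∀ g, (ρ g)ᴴ = ρ g⁻¹}
    {X : Matrix n n ℂ} {x : G → ℂ}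
    (h : ∀ g, trace (ρ g * X) = trace (ρ g * groupSum ρ x)) :
    IsCondExp (groupAlgebraImage ρ hρ) X (groupSum ρ x) := by
  refine ⟨⟨x, rfl⟩, ?_⟩
  rintro _ ⟨y, rfl⟩
  simp only [groupSum_apply ρ y, Finset.sum_mul, trace_sum, smul_mul_assoc, trace_smul, h]

theorem commute_groupSum {ρ : G →* Matrix n n ℂ} {N : Matrix n n ℂ} (h : ∀ g, ρ g * N = N * ρ g)
    (x : G → ℂ) : groupSum ρ x * N = N * groupSum ρ x := by
  simp only [groupSum_apply, Finset.sum_mul, Finset.mul_sum, smul_mul_assoc, mul_smul_comm, h]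

end GroupAlgebra

/-! ### Permutations of tensor factors -/

section SlotPerm

/-- The representation of `S_k` permuting the tensor factors of `(ℂ^α)^{⊗ k}`. -/
def slotPerm (k : ℕ) (α : Type*) [Fintype α] [DecidableEq α] :
    Equiv.Perm (Fin k) →* Matrix (Fin k → α) (Fin k → α) ℂ where
  toFun σ := Matrix.of fun f g => if f ∘ σ = g then 1 else 0
  map_one' := by
    ext f g
    simp [Matrix.one_apply]
  map_mul' σ τ := by
    ext f g
    rw [Matrix.mul_apply, Finset.sum_eq_single (f ∘ σ)]
    · simp [Function.comp_assoc]
      rfl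
    · intro j _ hj
      simp [hj.symm]
    · simp

variable {k : ℕ} {α : Type*} [Fintype α] [DecidableEq α]

theorem slotPerm_apply (σ : Equiv.Perm (Fin k)) (f g : Fin k → α) :
    slotPerm k α σ f g = if f ∘ σ = g then 1 else 0 :=
  rfl

theorem slotPerm_conjTranspose (σ : Equiv.Perm (Fin k)) :
    (slotPerm k α σ)ᴴ = slotPerm k α σ⁻¹ := by
  ext f g
  have : (g ∘ σ = f) ↔ (f ∘ ⇑σ⁻¹ = g) := by
    constructor
    · rintro rfl; funext i; simp
    · rintro rfl; funext i; simp
  simp only [conjTranspose_apply, slotPerm_apply, this]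
  split_ifs <;> simp

/-- Invariant colourings are the functions on the set of cycles. -/
theorem card_comp_eq_self (σ : Equiv.Perm (Fin k)) :
    Fintype.card {f : Fin k → α // f ∘ σ = f} = Fintype.card α ^ numCycles σ := by
  classical
  have hz : ∀ f : Fin k → α, f ∘ σ = f → ∀ x y, σ.SameCycle x y → f x = f y := by
    intro f hf x y hxy
    obtain ⟨i, -, hi⟩ := hxy.exists_pow_eq'
    have : ∀ j : ℕ, f ((σ ^ j) x) = f x := by
      intro j
      induction j with
      | zero => simp
      | succ j ih =>
        rw [pow_succ', Equiv.Perm.mul_apply, ← ih]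
        exact congrFun hf _
    rw [← hi, this]
  have e : {f : Fin k → α // f ∘ σ = f} ≃ (Quotient (Equiv.Perm.SameCycle.setoid σ) → α) :=
    { toFun := fun f => Quotient.lift f.1 fun x y h => hz f.1 f.2 x y h
      invFun := fun g => ⟨fun x => g (Quotient.mk _ x), by
        funext x
        exact congrArg g (Quotient.sound
          (show σ.SameCycle (σ x) x from (Equiv.Perm.sameCycle_apply_left).2 (.refl _ _)))⟩
      left_inv := fun f => by ext; rfl
      right_inv := fun g => by
        funext x
        induction x using Quotient.inductionOn with
        | _ x => rfl }
  rw [← Nat.card_eq_fintype_card, Nat.card_congr e, Nat.card_fun, Nat.card_eq_fintype_card]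
  rfl

theorem trace_slotPerm (σ : Equiv.Perm (Fin k)) :
    trace (slotPerm k α σ) = (Fintype.card α : ℂ) ^ numCycles σ := by
  rw [← Nat.cast_pow, ← card_comp_eq_self, Fintype.card_subtype]
  simp [trace, slotPerm_apply]

theorem numCycles_mul_comm (σ τ : Equiv.Perm (Fin k)) : numCycles (σ * τ) = numCycles (τ * σ) := by
  have h := trace_mul_comm (slotPerm k (Fin 2) σ) (slotPerm k (Fin 2) τ)
  rw [← map_mul, ← map_mul, trace_slotPerm, trace_slotPerm] at h
  simp only [Fintype.card_fin] at h
  exact Nat.pow_right_injective le_rfl (by exact_mod_cast h)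

/-- The representation of `S_k` permuting the factors of `(ℂ^d ⊗ ℂ^D)^{⊗ k}`, in the coordinates
of `(ℂ^d)^{⊗ k} ⊗ (ℂ^D)^{⊗ k}`. -/
noncomputable def slotPermProd (k d D : ℕ) :
    Equiv.Perm (Fin k) →* Matrix ((Fin k → Fin d) × (Fin k → Fin D))
      ((Fin k → Fin d) × (Fin k → Fin D)) ℂ where
  toFun σ := slotPerm k (Fin d) σ ⊗ₖ slotPerm k (Fin D) σ
  map_one' := by simp
  map_mul' σ τ := by simp [mul_kronecker_mul]

variable {d D : ℕ}

theorem slotPermProd_apply (σ : Equiv.Perm (Fin k)) :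
    slotPermProd k d D σ = slotPerm k (Fin d) σ ⊗ₖ slotPerm k (Fin D) σ :=
  rfl

theorem slotPermProd_conjTranspose (σ : Equiv.Perm (Fin k)) :
    (slotPermProd k d D σ)ᴴ = slotPermProd k d D σ⁻¹ := by
  rw [slotPermProd_apply, conjTranspose_kronecker, slotPerm_conjTranspose, slotPerm_conjTranspose,
    slotPermProd_apply]

theorem trace_slotPermProd (σ : Equiv.Perm (Fin k)) :
    trace (slotPermProd k d D σ) = ((d * D : ℕ) : ℂ) ^ numCycles σ := by
  rw [slotPermProd_apply, trace_kronecker, trace_slotPerm, trace_slotPerm]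
  simp [mul_pow]

/-- A constant multi-index is fixed by every permutation, so compressing to it recovers the action
on the second factor. -/
theorem slotPermProd_submatrix (f : Fin d) (σ : Equiv.Perm (Fin k)) :
    (slotPermProd k d D σ).submatrix (fun g => (fun _ => f, g)) (fun g => (fun _ => f, g)) =
      slotPerm k (Fin D) σ := by
  ext g h
  have : (fun _ : Fin k => f) ∘ σ = fun _ => f := rfl
  simp [slotPermProd_apply, kroneckerMap_apply, slotPerm_apply, this]

theorem groupSum_slotPermProd_submatrix (f : Fin d) (x : Equiv.Perm (Fin k) → ℂ) :
    (groupSum (slotPermProd k d D) x).submatrix (fun g => (fun _ => f, g))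
      (fun g => (fun _ => f, g)) = groupSum (slotPerm k (Fin D)) x := by
  ext g h
  simp only [submatrix_apply, groupSum_apply, Matrix.sum_apply, Matrix.smul_apply]
  refine Finset.sum_congr rfl fun σ _ => ?_
  rw [← slotPermProd_submatrix f σ]
  rfl

end SlotPerm

/-! ### Gram and Weingarten matrices as operator identities -/

section Gram

variable {k : ℕ} {n : Type*} [Fintype n] [DecidableEq n]

theorem gram_mulVec_apply {q : ℕ} {ρ : Equiv.Perm (Fin k) →* Matrix n n ℂ}
    (hq : ∀ σ, trace (ρ σ) = (q : ℂ) ^ numCycles σ) (y : Equiv.Perm (Fin k) → ℂ)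
    (σ : Equiv.Perm (Fin k)) :
    ((gram k q).map Complex.ofReal *ᵥ y) σ = trace (ρ σ⁻¹ * groupSum ρ y) := by
  simp only [mulVec, dotProduct, groupSum_apply, Finset.mul_sum, trace_sum, mul_smul_comm,
    trace_smul, ← map_mul, hq]
  refine Finset.sum_congr rfl fun τ _ => ?_
  have : numCycles (σ⁻¹ * τ) = numCycles (σ * τ⁻¹) := by
    rw [numCycles_mul_comm, ← numCycles_inv]; simp
  simp [gram, this, mul_comm]

theorem star_dotProduct_trace {ρ : Equiv.Perm (Fin k) →* Matrix n n ℂ}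
    (hρ : ∀ g, (ρ g)ᴴ = ρ g⁻¹) (x : Equiv.Perm (Fin k) → ℂ) (X : Matrix n n ℂ) :
    star x ⬝ᵥ (fun σ => trace (ρ σ⁻¹ * X)) = trace ((groupSum ρ x)ᴴ * X) := by
  simp only [groupSum_apply, conjTranspose_sum, conjTranspose_smul, hρ, Finset.sum_mul, trace_sum,
    smul_mul_assoc, trace_smul, dotProduct, Pi.star_apply, smul_eq_mul]

/-- The quadratic form of the Gram matrix is the squared Hilbert–Schmidt norm of `groupSum ρ x`. -/
theorem gram_mulVec_eq_zero_iff {q : ℕ} {ρ : Equiv.Perm (Fin k) →* Matrix n n ℂ}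
    (hρ : ∀ g, (ρ g)ᴴ = ρ g⁻¹) (hq : ∀ σ, trace (ρ σ) = (q : ℂ) ^ numCycles σ)
    {x : Equiv.Perm (Fin k) → ℂ} :
    (gram k q).map Complex.ofReal *ᵥ x = 0 ↔ groupSum ρ x = 0 := by
  refine ⟨fun h => ?_, fun h => ?_⟩
  · rw [← trace_conjTranspose_mul_self_eq_zero_iff, ← star_dotProduct_trace hρ]
    have : (fun σ => trace (ρ σ⁻¹ * groupSum ρ x)) = 0 := by
      rw [← h]; funext σ; rw [gram_mulVec_apply hq]
    rw [this]; simp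
  · funext σ
    rw [gram_mulVec_apply hq, h]; simp

theorem gram_conjTranspose (q : ℕ) :
    ((gram k q).map Complex.ofReal)ᴴ = (gram k q).map Complex.ofReal := by
  have := gram_isSelfAdjoint k q
  ext σ τ
  have h := congrFun (congrFun this σ) τ
  simp only [star_apply, star_trivial] at h
  simp [conjTranspose_apply, h]

theorem map_ofReal_mul {l m n : Type*} [Fintype m] (A : Matrix l m ℝ) (B : Matrix m n ℝ) :
    (A * B).map Complex.ofReal = A.map Complex.ofReal * B.map Complex.ofReal :=
  Matrix.map_mul (f := Complex.ofRealHom)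

/-- The range of the Gram matrix contains the vector of traces against the representation. -/
theorem gram_mul_weingarten_mulVec_trace {q : ℕ} {ρ : Equiv.Perm (Fin k) →* Matrix n n ℂ}
    (hρ : ∀ g, (ρ g)ᴴ = ρ g⁻¹) (hq : ∀ σ, trace (ρ σ) = (q : ℂ) ^ numCycles σ)
    (X : Matrix n n ℂ) :
    (gram k q).map Complex.ofReal *ᵥ (weingartenMatrix k q).map Complex.ofReal *ᵥ
      (fun σ => trace (ρ σ⁻¹ * X)) = fun σ => trace (ρ σ⁻¹ * X) := by
  set w : Equiv.Perm (Fin k) → ℂ := fun σ => trace (ρ σ⁻¹ * X)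
  set G := (gram k q).map Complex.ofReal with hG
  set W := (weingartenMatrix k q).map Complex.ofReal with hW
  have hGWG : G * W * G = G := by
    rw [hG, hW, ← map_ofReal_mul, ← map_ofReal_mul, gram_mul_weingartenMatrix_mul_gram]
  have hcomm : W * G = G * W := by
    rw [hG, hW, ← map_ofReal_mul, ← map_ofReal_mul, weingartenMatrix_commute_gram]
  -- The residual lies in `ker G`, so its group sum vanishes and it is orthogonal to `w`; it is also
  -- orthogonal to the range of `G`, hence to itself.
  set z := w - G *ᵥ W *ᵥ w with hz
  have hGz : G *ᵥ z = 0 := by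
    rw [hz, mulVec_sub, mulVec_mulVec, mulVec_mulVec, mul_assoc, ← hcomm, ← mul_assoc, hGWG,
      sub_self]
  have hzw : star z ⬝ᵥ w = 0 := by
    rw [star_dotProduct_trace hρ, (gram_mulVec_eq_zero_iff hρ hq).1 hGz]; simp
  have hzz : star z ⬝ᵥ z = 0 := by
    conv_lhs => rw [hz, dotProduct_sub, ← hz, hzw, dotProduct_mulVec]
    have : star z ᵥ* G = 0 := by
      rw [← (show Gᴴ = G from gram_conjTranspose q), ← star_mulVec, hGz, star_zero]
    rw [this]; simp
  have := dotProduct_star_self_eq_zero.1 (by rwa [dotProduct_comm] at hzz)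
  exact (sub_eq_zero.1 this).symm

theorem transferMatrix_one_eq (d D : ℕ) :
    transferMatrix d D (1 : Equiv.Perm (Fin k)) =
      weingartenMatrix k (d * D) * diagonal (fun σ => (d : ℝ) ^ numCycles σ) * gram k D := by
  ext τ θ
  simp only [transferMatrix, Matrix.of_apply, mul_one, wg_mul_inv]
  rw [Matrix.mul_apply]
  refine Finset.sum_congr rfl fun σ _ => ?_
  have h := congrFun (congrFun (weingartenMatrix_isSelfAdjoint k (d * D)) τ) σ
  simp only [star_apply, star_trivial] at h
  rw [mul_diagonal, ← h]
  simp [gram]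

/-- The transfer matrix implements, on coefficients, the conditional expectation of
`1 ⊗ R` onto the algebra generated by the permutations. -/
theorem isCondExp_transferMatrix (d D : ℕ) (y : Equiv.Perm (Fin k) → ℂ) :
    IsCondExp (groupAlgebraImage (slotPermProd k d D) slotPermProd_conjTranspose)
      (1 ⊗ₖ groupSum (slotPerm k (Fin D)) y)
      (groupSum (slotPermProd k d D)
        ((transferMatrix d D (1 : Equiv.Perm (Fin k))).map Complex.ofReal *ᵥ y)) := by
  have hw : (fun σ : Equiv.Perm (Fin k) =>
      trace (slotPermProd k d D σ⁻¹ * 1 ⊗ₖ groupSum (slotPerm k (Fin D)) y)) =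
      (diagonal (fun σ : Equiv.Perm (Fin k) => (d : ℝ) ^ numCycles σ)).map Complex.ofReal *ᵥ
        (gram k D).map Complex.ofReal *ᵥ y := by
    funext σ
    rw [slotPermProd_apply, ← mul_kronecker_mul, trace_kronecker, mul_one, trace_slotPerm,
      diagonal_map Complex.ofReal_zero, mulVec_diagonal,
      gram_mulVec_apply (ρ := slotPerm k (Fin D)) (by simp [trace_slotPerm]), numCycles_inv]
    simp
  refine isCondExp_groupAlgebraImage fun σ => ?_
  have h := gram_mul_weingarten_mulVec_trace (slotPermProd_conjTranspose (k := k))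
    (trace_slotPermProd (d := d) (D := D)) (1 ⊗ₖ groupSum (slotPerm k (Fin D)) y)
  have h1 := congrFun h σ⁻¹
  rw [gram_mulVec_apply (trace_slotPermProd (d := d) (D := D))] at h1
  rw [hw] at h1
  rw [transferMatrix_one_eq, map_ofReal_mul, map_ofReal_mul, ← mulVec_mulVec, ← mulVec_mulVec]
  simpa using h1.symm

end Gram
-- One-slot operators
section SlotUnit

variable {k : ℕ} {α : Type*} [Fintype α] [DecidableEq α]

/-- The matrix unit `|p⟩⟨q|` acting on the `i`-th factor of `(ℂ^α)^{⊗ k}`. -/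
def slotUnit (i : Fin k) (p q : α) : Matrix (Fin k → α) (Fin k → α) ℂ :=
  Matrix.of fun f g => if f i = p ∧ Function.update f i q = g then 1 else 0

theorem slotUnit_mulVec (i : Fin k) (p q : α) (φ : (Fin k → α) → ℂ) (f : Fin k → α) :
    (slotUnit i p q *ᵥ φ) f = if f i = p then φ (Function.update f i q) else 0 := by
  by_cases h : f i = p <;> simp [mulVec, dotProduct, slotUnit, h]

theorem slotPerm_mul_slotUnit (σ : Equiv.Perm (Fin k)) (i : Fin k) (p q : α) :
    slotPerm k α σ * slotUnit i p q = slotUnit (σ i) p q * slotPerm k α σ := by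
  ext f h
  have key : Function.update (f ∘ σ) i q = Function.update f (σ i) q ∘ σ := by
    rw [Function.update_comp_eq_of_injective _ σ.injective]
  rw [Matrix.mul_apply, Matrix.mul_apply, Finset.sum_eq_single (f ∘ σ),
    Finset.sum_eq_single (Function.update f (σ i) q)]
  · by_cases hp : f (σ i) = p <;> simp [slotPerm_apply, slotUnit, key, hp]
  · intro j _ hj
    simp [slotUnit, hj.symm]
  · simp
  · intro j _ hj
    simp [slotPerm_apply, hj.symm]
  · simp

/-- A matrix whose kernel is nonzero and invariant under all one-slot operators vanishes. -/
theorem eq_zero_of_ker_slotUnit_invariant {W : Matrix (Fin k → α) (Fin k → α) ℂ}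
    {φ : (Fin k → α) → ℂ} (hφ : φ ≠ 0) (hW : W *ᵥ φ = 0)
    (hinv : ∀ ψ, W *ᵥ ψ = 0 → ∀ i p q, W *ᵥ (slotUnit i p q *ᵥ ψ) = 0) : W = 0 := by
  obtain ⟨f₀, hf₀⟩ := Function.ne_iff.1 hφ
  -- The vector is `φ` after the matrix units `|g i⟩⟨f₀ i|` have acted on the slots in `s`; for all
  -- slots it is `φ f₀` times the basis vector at `g`.
  have key : ∀ (g : Fin k → α) (s : Finset (Fin k)),
      W *ᵥ (fun f => if ∀ i ∈ s, f i = g i then φ (s.piecewise f₀ f) else 0) = 0 := by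
    intro g s
    induction s using Finset.induction_on with
    | empty => simpa using hW
    | insert i s hi ih =>
      convert hinv _ ih i (g i) (f₀ i) using 2
      funext f
      rw [slotUnit_mulVec]
      have h1 : (∀ j ∈ s, Function.update f i (f₀ i) j = g j) ↔ ∀ j ∈ s, f j = g j := by
        refine forall₂_congr fun j hj => ?_
        rw [Function.update_of_ne (by rintro rfl; exact hi hj)]
      have h2 : s.piecewise f₀ (Function.update f i (f₀ i)) = (insert i s).piecewise f₀ f := by
        rw [Finset.piecewise_insert]
        funext j
        by_cases hj : j = i
        · subst hj; simp [hi]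
        · by_cases hjs : j ∈ s <;> simp [hj, hjs]
      simp only [h1, h2, Finset.forall_mem_insert]
      by_cases hfi : f i = g i <;> simp [hfi]
  ext f g
  have h := congrFun (key g Finset.univ) f
  have h3 : (fun f => if ∀ i ∈ (Finset.univ : Finset (Fin k)), f i = g i then
      φ (Finset.univ.piecewise f₀ f) else 0) = φ f₀ • (Pi.single g 1 : (Fin k → α) → ℂ) := by
    funext f
    simp [Pi.single_apply, funext_iff]
  rw [h3, mulVec_smul] at h
  exact (by simpa using h : φ f₀ = 0 ∨ W f g = 0).resolve_left hf₀

end SlotUnit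

/-! ### Slices of tensor-product vectors -/

section Kronecker

variable {m n : Type*} [Fintype m] [Fintype n]

theorem kronecker_mulVec_mul (A : Matrix m m ℂ) (B : Matrix n n ℂ) (u : m → ℂ) (v : n → ℂ) :
    (A ⊗ₖ B) *ᵥ (fun p => u p.1 * v p.2) = fun p => (A *ᵥ u) p.1 * (B *ᵥ v) p.2 := by
  funext p
  simp only [mulVec, dotProduct, kroneckerMap_apply, Fintype.sum_prod_type, Finset.sum_mul_sum]
  exact Finset.sum_congr rfl fun i _ => Finset.sum_congr rfl fun j _ => by ring

theorem star_dotProduct_slice_le (i : m) (w : m × n → ℂ) :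
    (star (fun j => w (i, j)) ⬝ᵥ fun j => w (i, j)) ≤ star w ⬝ᵥ w := by
  simp only [dotProduct, Fintype.sum_prod_type]
  exact Finset.single_le_sum (f := fun i => ∑ j, star w (i, j) * w (i, j))
    (fun i _ => Finset.sum_nonneg fun j _ => star_mul_self_nonneg (w (i, j))) (Finset.mem_univ i)

theorem one_kronecker_mulVec [DecidableEq m] (B : Matrix n n ℂ) (w : m × n → ℂ) (p : m × n) :
    ((1 : Matrix m m ℂ) ⊗ₖ B *ᵥ w) p = (B *ᵥ fun j => w (p.1, j)) p.2 := by
  simp [mulVec, dotProduct, kroneckerMap_apply, Fintype.sum_prod_type, one_apply]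

/-- The embedding of vectors in the second factor as `e_i ⊗ φ`. -/
def sliceVec [DecidableEq m] (i : m) (φ : n → ℂ) : m × n → ℂ :=
  fun p => (Pi.single i 1 : m → ℂ) p.1 * φ p.2

variable [DecidableEq m]

theorem kronecker_mulVec_sliceVec (A : Matrix m m ℂ) (B : Matrix n n ℂ) (i : m) (φ : n → ℂ) :
    (A ⊗ₖ B) *ᵥ sliceVec i φ = fun p => (A *ᵥ Pi.single i 1) p.1 * (B *ᵥ φ) p.2 :=
  kronecker_mulVec_mul A B _ φ

theorem mulVec_sliceVec (M : Matrix (m × n) (m × n) ℂ) (i : m) (φ : n → ℂ) (j : n) :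
    (M *ᵥ sliceVec i φ) (i, j) = (M.submatrix (fun g => (i, g)) (fun g => (i, g)) *ᵥ φ) j := by
  simp [mulVec, dotProduct, sliceVec, Fintype.sum_prod_type, Pi.single_apply]

theorem star_sliceVec_dotProduct (i : m) (φ : n → ℂ) (w : m × n → ℂ) :
    star (sliceVec i φ) ⬝ᵥ w = star φ ⬝ᵥ fun j => w (i, j) := by
  simp [dotProduct, sliceVec, Fintype.sum_prod_type, Pi.single_apply, apply_ite]

end Kronecker

/-! ### Spectral bound and fixed vectors via the expectation -/

section Channel

variable {k d D : ℕ}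

/-- The complex transfer matrix with trivial permutation. -/
noncomputable def complexTransfer (k d D : ℕ) :
    Matrix (Equiv.Perm (Fin k)) (Equiv.Perm (Fin k)) ℂ :=
  (transferMatrix d D (1 : Equiv.Perm (Fin k))).map Complex.ofReal

/-- The image of the unit of the group algebra under the transfer matrix, which is its fixed
vector. -/
noncomputable def fixedVec (k d D : ℕ) : Equiv.Perm (Fin k) → ℂ :=
  complexTransfer k d D *ᵥ Pi.single 1 1

theorem groupSum_slotPermProd_fixedVec : groupSum (slotPermProd k d D) (fixedVec k d D) = 1 := by
  have h := isCondExp_transferMatrix (k := k) d D (Pi.single 1 1)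
  rw [groupSum_single, map_one, one_kronecker_one] at h
  exact h.unique (IsCondExp.of_mem (one_mem _))

theorem groupSum_slotPerm_fixedVec (hd : 1 ≤ d) :
    groupSum (slotPerm k (Fin D)) (fixedVec k d D) = 1 := by
  rw [← groupSum_slotPermProd_submatrix (⟨0, hd⟩ : Fin d), groupSum_slotPermProd_fixedVec]
  exact submatrix_one _ fun _ _ h => (Prod.mk.inj h).2

/-- The rightmost factor of the transfer matrix is the Gram matrix for `D`, whose kernel is that of
`groupSum`. -/
theorem complexTransfer_mulVec_congr {x y : Equiv.Perm (Fin k) → ℂ}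
    (h : groupSum (slotPerm k (Fin D)) x = groupSum (slotPerm k (Fin D)) y) :
    complexTransfer k d D *ᵥ x = complexTransfer k d D *ᵥ y := by
  have h0 : (gram k D).map Complex.ofReal *ᵥ (x - y) = 0 := by
    rw [gram_mulVec_eq_zero_iff (ρ := slotPerm k (Fin D)) slotPerm_conjTranspose
      (by simp [trace_slotPerm]), map_sub, h, sub_self]
  rw [← sub_eq_zero, ← mulVec_sub, complexTransfer, transferMatrix_one_eq, map_ofReal_mul,
    ← mulVec_mulVec, h0, mulVec_zero]

theorem complexTransfer_mulVec_fixedVec (hd : 1 ≤ d) :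
    complexTransfer k d D *ᵥ fixedVec k d D = fixedVec k d D := by
  conv_rhs => rw [fixedVec]
  refine complexTransfer_mulVec_congr ?_
  rw [groupSum_slotPerm_fixedVec hd, groupSum_single, map_one]

theorem fixedVec_ne_zero (hd : 1 ≤ d) (hD : 1 ≤ D) : fixedVec k d D ≠ 0 := by
  intro h
  have h1 := groupSum_slotPerm_fixedVec (k := k) (D := D) hd
  rw [h, map_zero] at h1
  have := congrFun (congrFun h1 fun _ => ⟨0, hD⟩) fun _ => ⟨0, hD⟩
  simp at this

/-- The commutant of the permutation operators contains `∑ i, |p₁⟩⟨p₀|_i ⊗ |p⟩⟨q|_i`. -/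
theorem slotPermProd_mul_sum_slotUnit (σ : Equiv.Perm (Fin k)) (p₁ p₀ : Fin d) (p q : Fin D) :
    slotPermProd k d D σ * (∑ i, slotUnit i p₁ p₀ ⊗ₖ slotUnit i p q) =
      (∑ i, slotUnit i p₁ p₀ ⊗ₖ slotUnit i p q) * slotPermProd k d D σ := by
  rw [Finset.mul_sum, Finset.sum_mul]
  refine Fintype.sum_equiv σ _ _ fun i => ?_
  rw [slotPermProd_apply, ← mul_kronecker_mul, ← mul_kronecker_mul, slotPerm_mul_slotUnit,
    slotPerm_mul_slotUnit]

/-- Apply the commutant element `∑ i, |p₁⟩⟨p₀|_i ⊗ |p⟩⟨q|_i`, which preserves the kernel. The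
component with `p₁` in slot `j` and `p₀` elsewhere isolates the term `i = j`. -/
theorem ker_slotUnit_invariant {z : Equiv.Perm (Fin k) → ℂ}
    {W : Matrix (Fin k → Fin D) (Fin k → Fin D) ℂ} {p₀ p₁ : Fin d} (hne : p₀ ≠ p₁)
    (hker : ∀ v, groupSum (slotPermProd k d D) z *ᵥ v = 0 →
      ((1 : Matrix (Fin k → Fin d) (Fin k → Fin d) ℂ) ⊗ₖ W) *ᵥ v = 0)
    {φ : (Fin k → Fin D) → ℂ}
    (hφ : groupSum (slotPermProd k d D) z *ᵥ sliceVec (fun _ => p₀) φ = 0) (j : Fin k)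
    (p q : Fin D) : W *ᵥ (slotUnit j p q *ᵥ φ) = 0 := by
  have h1 : groupSum (slotPermProd k d D) z *ᵥ
      ((∑ i, slotUnit i p₁ p₀ ⊗ₖ slotUnit i p q) *ᵥ sliceVec (fun _ => p₀) φ) = 0 := by
    rw [mulVec_mulVec, commute_groupSum fun σ => slotPermProd_mul_sum_slotUnit σ p₁ p₀ p q,
      ← mulVec_mulVec, hφ, mulVec_zero]
  have h2 := hker _ h1
  have h3 : ∀ g, ((∑ i, slotUnit i p₁ p₀ ⊗ₖ slotUnit i p q) *ᵥ sliceVec (fun _ => p₀) φ)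
      (Function.update (fun _ => p₀) j p₁, g) = (slotUnit j p q *ᵥ φ) g := by
    intro g
    rw [sum_mulVec, Finset.sum_apply, Finset.sum_eq_single j]
    · simp [kronecker_mulVec_sliceVec, slotUnit]
    · intro i _ hi
      simp [kronecker_mulVec_sliceVec, slotUnit, hi, hne]
    · simp
  funext g
  have h4 := congrFun h2 (Function.update (fun _ => p₀) j p₁, g)
  rw [one_kronecker_mulVec] at h4
  simp only [h3] at h4
  exact h4

/-- Kadison–Schwarz at a top eigenvector of `Zᴴ * Z` gives the bound; its equality case, spread by
one-slot operators, gives the scalar identity. -/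
theorem norm_le_one_and_scalar (hd : 2 ≤ d) (hD : 1 ≤ D) {x : Equiv.Perm (Fin k) → ℂ} {μ : ℂ}
    (hx : complexTransfer k d D *ᵥ x = μ • x) (hZ : groupSum (slotPerm k (Fin D)) x ≠ 0) :
    ‖μ‖ ≤ 1 ∧ (μ = 1 → ∃ m : ℂ, (groupSum (slotPerm k (Fin D)) x)ᴴ *
      groupSum (slotPerm k (Fin D)) x = m • 1) := by
  have : Nonempty (Fin k → Fin D) := ⟨fun _ => ⟨0, hD⟩⟩
  set Z := groupSum (slotPerm k (Fin D)) x with hZdef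
  obtain ⟨y, hy⟩ : ∃ y, groupSum (slotPerm k (Fin D)) y = Zᴴ * Z := by
    have hZm : Z ∈ groupAlgebraImage (slotPerm k (Fin D)) slotPerm_conjTranspose := ⟨x, rfl⟩
    exact mul_mem (conjTranspose_mem hZm) hZm
  have hYps : (Zᴴ * Z).PosSemidef := posSemidef_conjTranspose_mul_self Z
  obtain ⟨m, φ, hφ0, hφ, hmY⟩ := exists_max_eigenvector hYps.1
  have hm0 : 0 < m := by
    have hN : 0 < star φ ⬝ᵥ φ := dotProduct_star_self_pos_iff.2 hφ0
    have h1 := hYps.dotProduct_mulVec_nonneg φ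
    rw [hφ, dotProduct_smul, smul_eq_mul] at h1
    have h2 : (0 : ℂ) ≤ m := le_of_mul_le_mul_right (by rwa [zero_mul]) hN
    rcases (Complex.zero_le_real.1 h2).lt_or_eq with h | h
    · exact h
    · rw [← h, Complex.ofReal_zero, zero_smul, zero_sub] at hmY
      have h3 : Zᴴ * Z ≤ 0 := by rw [le_iff, zero_sub]; exact hmY
      have h4 := le_antisymm h3 (nonneg_iff_posSemidef.2 hYps)
      exact absurd (conjTranspose_mul_self_eq_zero.1 h4) hZ
  set b := groupSum (slotPermProd k d D) (complexTransfer k d D *ᵥ y) with hb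
  set z := (m : ℂ) • fixedVec k d D - complexTransfer k d D *ᵥ y with hzdef
  have hz : groupSum (slotPermProd k d D) z = (m : ℂ) • 1 - b := by
    rw [hzdef, map_sub, map_smul, groupSum_slotPermProd_fixedVec]
  have hEa := isCondExp_transferMatrix (k := k) d D x
  rw [← complexTransfer, hx, ← hZdef] at hEa
  have hEb := isCondExp_transferMatrix (k := k) d D y
  rw [← complexTransfer, hy, ← hb] at hEb
  have hEc : IsCondExp (groupAlgebraImage (slotPermProd k d D) slotPermProd_conjTranspose)
      (1 ⊗ₖ ((m : ℂ) • (1 : Matrix (Fin k → Fin D) (Fin k → Fin D) ℂ) - Zᴴ * Z))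
      (groupSum (slotPermProd k d D) z) := by
    rw [hz]
    convert ((IsCondExp.of_mem (one_mem _)).smul (m : ℂ)).sub hEb using 1
    rw [sub_eq_add_neg, kronecker_add, kronecker_smul, one_kronecker_one, sub_eq_add_neg]
    congr 1
    ext i j
    simp [kroneckerMap_apply]
  obtain ⟨hcps, hker⟩ := hEc.posSemidef_and_ker (PosSemidef.one.kronecker hmY)
  set a := groupSum (slotPermProd k d D) (μ • x) with ha
  have hschwarz : (b - aᴴ * a).PosSemidef := by
    refine hEa.schwarz ?_
    rwa [conjTranspose_kronecker, ← mul_kronecker_mul, conjTranspose_one, one_mul]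
  set p₀ : Fin d := ⟨0, by omega⟩
  have hp : p₀ ≠ ⟨1, by omega⟩ := by simp [p₀]
  have hasub : a.submatrix (fun g => ((fun _ => p₀ : Fin k → Fin d), g)) (fun g => (fun _ => p₀, g))
      = μ • Z := by
    rw [ha, groupSum_slotPermProd_submatrix, map_smul]
  -- the expectation of `b` in `e₀ ⊗ ψ`, for `ψ` in the top eigenspace
  have hlow : ∀ ψ : (Fin k → Fin D) → ℂ, (Zᴴ * Z) *ᵥ ψ = (m : ℂ) • ψ →
      star μ * μ * (m * (star ψ ⬝ᵥ ψ)) ≤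
        star (sliceVec (fun _ => p₀) ψ) ⬝ᵥ b *ᵥ sliceVec (fun _ => p₀) ψ := by
    intro ψ hψ
    have h1 := hschwarz.dotProduct_mulVec_nonneg (sliceVec (fun _ => p₀) ψ)
    rw [sub_mulVec, dotProduct_sub, sub_nonneg] at h1
    refine le_trans ?_ h1
    rw [← mulVec_mulVec, dotProduct_mulVec, ← star_mulVec]
    refine le_trans (le_of_eq ?_) (star_dotProduct_slice_le (fun _ => p₀) _)
    simp only [mulVec_sliceVec, hasub]
    change _ = star ((μ • Z) *ᵥ ψ) ⬝ᵥ ((μ • Z) *ᵥ ψ)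
    rw [smul_mulVec, star_smul, smul_dotProduct, dotProduct_smul, star_mulVec, ← dotProduct_mulVec,
      mulVec_mulVec, hψ, dotProduct_smul]
    simp only [smul_eq_mul]
    ring
  have hexp : ∀ ψ : (Fin k → Fin D) → ℂ, star (sliceVec (fun _ => p₀) ψ) ⬝ᵥ
      groupSum (slotPermProd k d D) z *ᵥ sliceVec (fun _ => p₀) ψ = m * (star ψ ⬝ᵥ ψ) -
        star (sliceVec (fun _ => p₀) ψ) ⬝ᵥ b *ᵥ sliceVec (fun _ => p₀) ψ := by
    intro ψ
    rw [hz, sub_mulVec, dotProduct_sub, smul_mulVec, one_mulVec, dotProduct_smul,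
      star_sliceVec_dotProduct]
    simp [sliceVec]
  constructor
  · have h1 := hlow φ hφ
    have h2 := hcps.dotProduct_mulVec_nonneg (sliceVec (fun _ => p₀) φ)
    rw [hexp, sub_nonneg] at h2
    have h3 := h1.trans h2
    have hpos : (0 : ℂ) < m * (star φ ⬝ᵥ φ) :=
      mul_pos (Complex.zero_lt_real.2 hm0) (dotProduct_star_self_pos_iff.2 hφ0)
    have h4 : star μ * μ ≤ 1 := le_of_mul_le_mul_right (by rwa [one_mul]) hpos
    have h5 : star μ * μ = ((‖μ‖ ^ 2 : ℝ) : ℂ) := by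
      rw [Complex.ofReal_pow]; exact Complex.conj_mul' μ
    rw [h5] at h4
    have h6 : ‖μ‖ ^ 2 ≤ 1 := by exact_mod_cast h4
    exact (sq_le_one_iff₀ (norm_nonneg _)).1 h6
  · rintro rfl
    refine ⟨m, (sub_eq_zero.1 ?_).symm⟩
    have hiff : ∀ ψ : (Fin k → Fin D) → ℂ,
        ((m : ℂ) • (1 : Matrix (Fin k → Fin D) (Fin k → Fin D) ℂ) - Zᴴ * Z) *ᵥ ψ = 0 →
          (Zᴴ * Z) *ᵥ ψ = (m : ℂ) • ψ := by
      intro ψ hψ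
      rw [sub_mulVec, smul_mulVec, one_mulVec, sub_eq_zero] at hψ
      exact hψ.symm
    refine eq_zero_of_ker_slotUnit_invariant hφ0 ?_ fun ψ hψ j p q => ?_
    · rw [sub_mulVec, hφ, smul_mulVec, one_mulVec, sub_self]
    · refine ker_slotUnit_invariant hp hker ?_ j p q
      -- With `μ = 1` the lower bound `hlow` meets the upper bound from `hcps`, so the positive form
      -- vanishes at this vector.
      refine (hcps.dotProduct_mulVec_zero_iff _).1 (le_antisymm ?_
        (hcps.dotProduct_mulVec_nonneg _))
      rw [hexp, sub_nonpos]
      simpa using hlow ψ (hiff ψ hψ)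

/-- Fixed vectors of the transfer matrix are multiples of `fixedVec`. -/
theorem eq_smul_fixedVec (hd : 2 ≤ d) (hD : 1 ≤ D) {x : Equiv.Perm (Fin k) → ℂ}
    (hx : complexTransfer k d D *ᵥ x = x) : ∃ c : ℂ, x = c • fixedVec k d D := by
  have hd1 : 1 ≤ d := by omega
  have : Nonempty (Fin k → Fin D) := ⟨fun _ => ⟨0, hD⟩⟩
  set Z := groupSum (slotPerm k (Fin D)) x with hZ
  -- Shifting by an eigenvalue makes `Z - c` singular; since `(Z - c)ᴴ (Z - c)` is scalar, it must
  -- be zero.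
  obtain ⟨c, hc⟩ := Module.End.exists_eigenvalue (Matrix.toLin' Z)
  obtain ⟨v, hv⟩ := hc.exists_hasEigenvector
  have hv1 : Z *ᵥ v = c • v := by simpa using hv.apply_eq_smul
  have hx' : complexTransfer k d D *ᵥ (x - c • fixedVec k d D) =
      (1 : ℂ) • (x - c • fixedVec k d D) := by
    rw [mulVec_sub, mulVec_smul, hx, complexTransfer_mulVec_fixedVec hd1, one_smul]
  have hZ' : groupSum (slotPerm k (Fin D)) (x - c • fixedVec k d D) = Z - c • 1 := by
    rw [map_sub, map_smul, groupSum_slotPerm_fixedVec hd1]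
  have hker : (Z - c • 1) *ᵥ v = 0 := by
    rw [sub_mulVec, hv1, smul_mulVec, one_mulVec, sub_self]
  have h0 : groupSum (slotPerm k (Fin D)) (x - c • fixedVec k d D) = 0 := by
    by_contra hne
    obtain ⟨m, hm⟩ := (norm_le_one_and_scalar hd hD hx' hne).2 rfl
    rw [hZ'] at hm hne
    have h1 : m • v = 0 := by
      have h2 := congrArg (· *ᵥ v) hm
      simpa [← mulVec_mulVec, hker, smul_mulVec] using h2.symm
    rcases smul_eq_zero.1 h1 with h | h
    · rw [h, zero_smul] at hm
      exact hne (conjTranspose_mul_self_eq_zero.1 hm)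
    · exact hv.2 h
  refine ⟨c, sub_eq_zero.1 ?_⟩
  rw [← one_smul ℂ (x - c • fixedVec k d D), ← hx', complexTransfer_mulVec_congr (y := 0) (by
    rw [h0, map_zero]), mulVec_zero]

theorem norm_eigenvalue_le_one (hd : 2 ≤ d) (hD : 1 ≤ D) {x : Equiv.Perm (Fin k) → ℂ} {μ : ℂ}
    (hx : complexTransfer k d D *ᵥ x = μ • x) (hx0 : x ≠ 0) : ‖μ‖ ≤ 1 := by
  by_cases hZ : groupSum (slotPerm k (Fin D)) x = 0
  · rw [complexTransfer_mulVec_congr (y := 0) (by rw [hZ, map_zero]), mulVec_zero] at hx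
    have : μ = 0 := (smul_eq_zero.1 hx.symm).resolve_right hx0
    simp [this]
  · exact (norm_le_one_and_scalar hd hD hx hZ).1

end Channel
-- Non-negativity, semisimplicity and real eigenspaces
section Positivity

variable {k : ℕ}

theorem gram_map_posSemidef (k q : ℕ) : ((gram k q).map Complex.ofReal).PosSemidef := by
  refine .of_dotProduct_mulVec_nonneg (gram_conjTranspose q) fun x => ?_
  have h : (gram k q).map Complex.ofReal *ᵥ x =
      fun σ => trace (slotPerm k (Fin q) σ⁻¹ * groupSum (slotPerm k (Fin q)) x) := by
    funext σ
    exact gram_mulVec_apply (by simp [trace_slotPerm]) x σ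
  rw [h, star_dotProduct_trace slotPerm_conjTranspose]
  exact (posSemidef_conjTranspose_mul_self _).trace_nonneg

theorem ofReal_dotProduct_mulVec {n : Type*} [Fintype n] (A : Matrix n n ℝ) (x : n → ℝ) :
    ((star x ⬝ᵥ A *ᵥ x : ℝ) : ℂ) =
      star (fun i => (x i : ℂ)) ⬝ᵥ A.map Complex.ofReal *ᵥ fun i => (x i : ℂ) := by
  simp [dotProduct, mulVec]

theorem gram_posSemidef (k q : ℕ) : (gram k q).PosSemidef := by
  refine .of_dotProduct_mulVec_nonneg (gram_isSelfAdjoint k q) fun x => ?_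
  rw [← Complex.zero_le_real, ofReal_dotProduct_mulVec]
  exact (gram_map_posSemidef k q).dotProduct_mulVec_nonneg _

theorem gram_commute_gram (k p q : ℕ) : Commute (gram k p) (gram k q) := by
  ext σ τ
  simp only [Matrix.mul_apply, gram, Matrix.of_apply]
  -- The substitution `α ↦ σ α⁻¹ τ` exchanges the two factors, because `#` is a class function.
  refine Fintype.sum_equiv (((Equiv.inv _).trans (Equiv.mulLeft σ)).trans (Equiv.mulRight τ)) _ _
    fun α => ?_
  have h1 : numCycles (σ * (σ * α⁻¹ * τ)⁻¹) = numCycles (α * τ⁻¹) := by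
    rw [show σ * (σ * α⁻¹ * τ)⁻¹ = σ * (τ⁻¹ * α * σ⁻¹) by group, numCycles_mul_comm,
      show τ⁻¹ * α * σ⁻¹ * σ = τ⁻¹ * α by group, numCycles_mul_comm]
  have h2 : numCycles (σ * α⁻¹ * τ * τ⁻¹) = numCycles (σ * α⁻¹) := by
    rw [mul_inv_cancel_right]
  simp only [Equiv.trans_apply, Equiv.inv_apply, Equiv.coe_mulLeft, Equiv.coe_mulRight, h1, h2]
  ring

theorem gram_commute_weingartenMatrix (k p q : ℕ) :
    Commute (gram k p) (weingartenMatrix k q) :=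
  ((gram_isSelfAdjoint k q).commute_cfc (gram_commute_gram k q p) _).symm

/-- The square root `S` of the Weingarten matrix commutes with every Gram matrix, so the product is
`S G S`. -/
theorem gram_mul_weingartenMatrix_posSemidef (k p q : ℕ) :
    ((gram k p * weingartenMatrix k q).map Complex.ofReal).PosSemidef := by
  have hc := continuousOn_spectrum_gram k q
  set S := cfc (fun x : ℝ => √(x⁻¹)) (gram k q) with hS
  have hW : weingartenMatrix k q = S * S := by
    rw [hS, ← cfc_mul _ _ _ (hc _) (hc _)]
    refine cfc_congr fun x hx => ?_
    have hx0 : 0 ≤ x :=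
      spectrum_nonneg_of_nonneg (nonneg_iff_posSemidef.2 (gram_posSemidef k q)) hx
    exact (Real.mul_self_sqrt (inv_nonneg.2 hx0)).symm
  have hcomm : Commute S (gram k p) :=
    (gram_isSelfAdjoint k q).commute_cfc (gram_commute_gram k q p) _
  have hSsa : Sᴴ = S := (cfc_predicate _ (gram k q) : IsSelfAdjoint S)
  have hSC : (S.map Complex.ofReal)ᴴ = S.map Complex.ofReal := by
    ext i j
    simpa using congrFun (congrFun hSsa i) j
  rw [hW, ← mul_assoc, ← hcomm.eq, map_ofReal_mul, map_ofReal_mul]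
  have := (gram_map_posSemidef k p).mul_mul_conjTranspose_same (S.map Complex.ofReal)
  rwa [hSC] at this

theorem gram_mul_transferMatrix (d D : ℕ) :
    gram k D * transferMatrix d D (1 : Equiv.Perm (Fin k)) =
      gram k D * weingartenMatrix k (d * D) *
        diagonal (fun σ => (d : ℝ) ^ numCycles σ) * gram k D := by
  rw [transferMatrix_one_eq]
  noncomm_ring

variable {d D : ℕ}

/-- With `w = G x`, pairing `P Δ w = μ w` with `Δ w` compares a non-negative number with `μ` times a
positive one, unless `w = 0`, where `μ = 0`. -/
theorem eigenvalue_nonneg (hd : 1 ≤ d) {x : Equiv.Perm (Fin k) → ℂ} {μ : ℂ} (hx0 : x ≠ 0)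
    (hx : complexTransfer k d D *ᵥ x = μ • x) : 0 ≤ μ := by
  set G := (gram k D).map Complex.ofReal with hG
  set Δ : Matrix (Equiv.Perm (Fin k)) (Equiv.Perm (Fin k)) ℂ :=
    (diagonal (fun σ => (d : ℝ) ^ numCycles σ)).map Complex.ofReal with hΔ
  have hΔd : Δ = diagonal (fun σ => (d : ℂ) ^ numCycles σ) := by
    rw [hΔ, diagonal_map Complex.ofReal_zero]
    simp
  have hΔpos : Δ.PosDef := by
    rw [hΔd]
    refine PosDef.diagonal fun σ => ?_
    have : (0 : ℂ) < d := by exact_mod_cast hd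
    exact pow_pos this _
  set w := G *ᵥ x with hw
  by_cases hw0 : w = 0
  · have : complexTransfer k d D *ᵥ x = 0 := by
      rw [complexTransfer, transferMatrix_one_eq, map_ofReal_mul, ← mulVec_mulVec, ← hG, ← hw, hw0,
        mulVec_zero]
    rw [this] at hx
    rw [(smul_eq_zero.1 hx.symm).resolve_right hx0]
  · have hP := gram_mul_weingartenMatrix_posSemidef k D (d * D)
    have h1 : (gram k D * weingartenMatrix k (d * D)).map Complex.ofReal *ᵥ Δ *ᵥ w = μ • w := by
      rw [hw, ← mulVec_smul, ← hx, complexTransfer, mulVec_mulVec, mulVec_mulVec, mulVec_mulVec,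
        hG, hΔ, ← map_ofReal_mul, ← map_ofReal_mul, ← map_ofReal_mul, gram_mul_transferMatrix]
    have h2 := hP.dotProduct_mulVec_nonneg (Δ *ᵥ w)
    rw [h1, dotProduct_smul, star_mulVec, hΔpos.1.eq, ← dotProduct_mulVec, smul_eq_mul] at h2
    exact le_of_mul_le_mul_right (by rwa [zero_mul]) (hΔpos.dotProduct_mulVec_pos hw0)

/-- This excludes a Jordan chain of length two at `1`: `P Δ` is symmetric for the form of `Δ`, so `G
u`, fixed by `P Δ` and in the range of `P Δ - 1`, is orthogonal to itself. -/
theorem transferMatrix_semisimple (hd : 1 ≤ d) {x u : Equiv.Perm (Fin k) → ℝ}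
    (hu : transferMatrix d D (1 : Equiv.Perm (Fin k)) *ᵥ x - x = u)
    (hTu : transferMatrix d D (1 : Equiv.Perm (Fin k)) *ᵥ u = u) : u = 0 := by
  set G := gram k D with hG
  set Δ : Matrix (Equiv.Perm (Fin k)) (Equiv.Perm (Fin k)) ℝ :=
    diagonal (fun σ => (d : ℝ) ^ numCycles σ) with hΔ
  set P := G * weingartenMatrix k (d * D) with hP
  have hΔpos : Δ.PosDef := by
    refine PosDef.diagonal fun σ => ?_
    have : (0 : ℝ) < d := by exact_mod_cast hd
    exact pow_pos this _
  have hPs : Pᵀ = P := by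
    rw [hP, transpose_mul, (gram_commute_weingartenMatrix k D (d * D)).eq]
    have h1 : (weingartenMatrix k (d * D))ᵀ = weingartenMatrix k (d * D) :=
      weingartenMatrix_isSelfAdjoint k (d * D)
    have h2 : Gᵀ = G := gram_isSelfAdjoint k D
    rw [h1, h2]
  have hPΔ : ∀ v, P *ᵥ Δ *ᵥ G *ᵥ v = G *ᵥ transferMatrix d D (1 : Equiv.Perm (Fin k)) *ᵥ v := by
    intro v
    rw [mulVec_mulVec _ G, gram_mul_transferMatrix]
    simp only [mulVec_mulVec, mul_assoc, hP, hΔ, hG]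
  have h1 : P *ᵥ Δ *ᵥ G *ᵥ u = G *ᵥ u := by rw [hPΔ, hTu]
  have h2 : G *ᵥ u = P *ᵥ Δ *ᵥ G *ᵥ x - G *ᵥ x := by rw [hPΔ, ← hu, mulVec_sub]
  have hΔs : ∀ v w : Equiv.Perm (Fin k) → ℝ, (Δ *ᵥ v) ⬝ᵥ w = v ⬝ᵥ Δ *ᵥ w := by
    intro v w
    rw [dotProduct_mulVec, ← mulVec_transpose, hΔ, diagonal_transpose]
  have hPsym : ∀ v w : Equiv.Perm (Fin k) → ℝ, (P *ᵥ v) ⬝ᵥ w = v ⬝ᵥ P *ᵥ w := by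
    intro v w
    rw [dotProduct_mulVec, ← mulVec_transpose, hPs]
  have h3 : (G *ᵥ u) ⬝ᵥ Δ *ᵥ G *ᵥ u = 0 := by
    rw [← hΔs]
    nth_rw 2 [h2]
    rw [dotProduct_sub, ← hPsym, h1, hΔs, sub_self]
  have h4 : G *ᵥ u = 0 := by
    by_contra h
    have := hΔpos.dotProduct_mulVec_pos h
    rw [star_trivial, h3] at this
    exact lt_irrefl _ this
  rw [← hTu, transferMatrix_one_eq, ← mulVec_mulVec, h4, mulVec_zero]

theorem complexTransfer_mulVec_ofReal (x : Equiv.Perm (Fin k) → ℝ) :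
    (complexTransfer k d D *ᵥ fun σ => (x σ : ℂ)) =
      fun σ => ((transferMatrix d D (1 : Equiv.Perm (Fin k)) *ᵥ x) σ : ℂ) := by
  funext σ
  simp [complexTransfer, mulVec, dotProduct]

/-- The real fixed vector of the transfer matrix. -/
noncomputable def realFixedVec (k d D : ℕ) : Equiv.Perm (Fin k) → ℝ :=
  transferMatrix d D (1 : Equiv.Perm (Fin k)) *ᵥ Pi.single 1 1

theorem ofReal_realFixedVec :
    (fun σ => (realFixedVec k d D σ : ℂ)) = fixedVec k d D := by
  rw [realFixedVec, ← complexTransfer_mulVec_ofReal, fixedVec]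
  congr 1
  funext σ
  by_cases h : σ = 1 <;> simp [h]

theorem realFixedVec_ne_zero (hd : 1 ≤ d) (hD : 1 ≤ D) : realFixedVec k d D ≠ 0 := by
  intro h
  refine fixedVec_ne_zero (k := k) hd hD ?_
  rw [← ofReal_realFixedVec, h]
  funext σ
  simp

theorem transferMatrix_mulVec_realFixedVec (hd : 1 ≤ d) :
    transferMatrix d D (1 : Equiv.Perm (Fin k)) *ᵥ realFixedVec k d D = realFixedVec k d D := by
  have h := complexTransfer_mulVec_fixedVec (k := k) (D := D) hd
  rw [← ofReal_realFixedVec, complexTransfer_mulVec_ofReal] at h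
  funext σ
  exact_mod_cast congrFun h σ

theorem eq_smul_realFixedVec (hd : 2 ≤ d) (hD : 1 ≤ D) {x : Equiv.Perm (Fin k) → ℝ}
    (hx : transferMatrix d D (1 : Equiv.Perm (Fin k)) *ᵥ x = x) :
    ∃ c : ℝ, c • realFixedVec k d D = x := by
  obtain ⟨c, hc⟩ := eq_smul_fixedVec (k := k) hd hD (x := fun σ => (x σ : ℂ)) (by
    rw [complexTransfer_mulVec_ofReal, hx])
  refine ⟨c.re, ?_⟩
  rw [← ofReal_realFixedVec] at hc
  funext σ
  have := congrArg Complex.re (congrFun hc σ)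
  simpa using this.symm

theorem mem_eigenspace_one {x : Equiv.Perm (Fin k) → ℝ} :
    x ∈ Module.End.eigenspace
      (Matrix.toLin' (transferMatrix d D (1 : Equiv.Perm (Fin k)))) 1 ↔
      transferMatrix d D (1 : Equiv.Perm (Fin k)) *ᵥ x = x := by
  rw [Module.End.mem_eigenspace_iff, toLin'_apply, one_smul]

theorem finrank_eigenspace_one (hd : 2 ≤ d) (hD : 1 ≤ D) :
    Module.finrank ℝ (Module.End.eigenspace
      (Matrix.toLin' (transferMatrix d D (1 : Equiv.Perm (Fin k)))) 1) = 1 := by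
  have hd1 : 1 ≤ d := by omega
  refine finrank_eq_one ⟨realFixedVec k d D,
    mem_eigenspace_one.2 (transferMatrix_mulVec_realFixedVec hd1)⟩ ?_ ?_
  · intro h
    exact realFixedVec_ne_zero hd1 hD (congrArg Subtype.val h)
  · rintro ⟨x, hx⟩
    obtain ⟨c, hc⟩ := eq_smul_realFixedVec hd hD (mem_eigenspace_one.1 hx)
    exact ⟨c, Subtype.ext hc⟩

theorem maxGenEigenspace_one_eq (hd : 1 ≤ d) :
    Module.End.maxGenEigenspace
      (Matrix.toLin' (transferMatrix d D (1 : Equiv.Perm (Fin k)))) 1 =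
    Module.End.eigenspace (Matrix.toLin' (transferMatrix d D (1 : Equiv.Perm (Fin k)))) 1 := by
  set T := Matrix.toLin' (transferMatrix d D (1 : Equiv.Perm (Fin k))) with hT
  refine le_antisymm (fun x hx => ?_) (Module.End.genEigenspace_le_maximal _ _ 1)
  obtain ⟨n, hn⟩ := Module.End.mem_maxGenEigenspace _ _ _ |>.1 hx
  -- Peeling off one factor at a time, semisimplicity shortens any generalized eigenvector chain to
  -- length one.
  have key : ∀ n : ℕ, ∀ x, ((T - (1 : ℝ) • 1) ^ n) x = 0 → T x = x := by
    intro n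
    induction n with
    | zero =>
      intro x h
      have : x = 0 := by simpa using h
      rw [this, map_zero]
    | succ n ih =>
      intro x h
      rw [pow_succ, Module.End.mul_apply] at h
      have h1 := ih _ h
      have h2 : (T - (1 : ℝ) • 1) x = T x - x := by simp
      rw [h2] at h1
      exact sub_eq_zero.1 (transferMatrix_semisimple hd rfl h1)
  exact mem_eigenspace_one.2 (key n x hn)

end Positivity
end RandomMPS

theorem proposition3 (k d D : ℕ) (hk : 2 ≤ k) (hd : 2 ≤ d) (hD : 1 ≤ D) :
    -- all complex eigenvalues of `T_e` are real and non-negative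
    (∀ μ ∈ spectrum ℂ ((RandomMPS.transferMatrix d D (1 : Equiv.Perm (Fin k))).map
        (algebraMap ℝ ℂ)), ∃ r : ℝ, 0 ≤ r ∧ μ = (r : ℂ)) ∧
    -- the largest eigenvalue is `1`
    IsGreatest (spectrum ℝ (RandomMPS.transferMatrix d D (1 : Equiv.Perm (Fin k)))) 1 ∧
    -- and it is non-degenerate, both algebraically and geometrically
    (RandomMPS.transferMatrix d D (1 : Equiv.Perm (Fin k))).charpoly.rootMultiplicity 1 = 1 ∧
    Module.finrank ℝ (Module.End.eigenspace
      (Matrix.toLin' (RandomMPS.transferMatrix d D (1 : Equiv.Perm (Fin k)))) 1) = 1 := by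
  open RandomMPS Matrix in
  have hd1 : 1 ≤ d := by omega
  refine ⟨fun μ hμ => ?_, ⟨?_, fun μ hμ => ?_⟩, ?_, finrank_eigenspace_one hd hD⟩
  · rw [← Matrix.spectrum_toLin', ← Module.End.hasEigenvalue_iff_mem_spectrum] at hμ
    obtain ⟨x, hx⟩ := hμ.exists_hasEigenvector
    have h : complexTransfer k d D *ᵥ x = μ • x := hx.apply_eq_smul
    have h0 := eigenvalue_nonneg hd1 hx.2 h
    exact ⟨μ.re, (Complex.nonneg_iff.1 h0).1, Complex.ext rfl (Complex.nonneg_iff.1 h0).2.symm⟩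
  · rw [← Matrix.spectrum_toLin', ← Module.End.hasEigenvalue_iff_mem_spectrum]
    exact Module.End.hasEigenvalue_of_hasEigenvector
      ⟨mem_eigenspace_one.2 (transferMatrix_mulVec_realFixedVec hd1), realFixedVec_ne_zero hd1 hD⟩
  · rw [← Matrix.spectrum_toLin', ← Module.End.hasEigenvalue_iff_mem_spectrum] at hμ
    obtain ⟨x, hx⟩ := hμ.exists_hasEigenvector
    have h : transferMatrix d D (1 : Equiv.Perm (Fin k)) *ᵥ x = μ • x := hx.apply_eq_smul
    have hC : complexTransfer k d D *ᵥ (fun σ => (x σ : ℂ)) = (μ : ℂ) • fun σ => (x σ : ℂ) := by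
      rw [complexTransfer_mulVec_ofReal, h]
      funext σ
      simp
    have hx0 : (fun σ => (x σ : ℂ)) ≠ 0 := fun h0 => hx.2 (by
      funext σ
      exact Complex.ofReal_eq_zero.1 (congrFun h0 σ))
    have := norm_eigenvalue_le_one hd hD hC hx0
    rw [Complex.norm_real] at this
    exact (le_abs_self μ).trans this
  · rw [← Matrix.charpoly_toLin', ← LinearMap.finrank_maxGenEigenspace_eq,
      maxGenEigenspace_one_eq hd1, finrank_eigenspace_one hd hD]
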